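/- Let $n \ge m$ be natural numbers and let $\mathfrak{M}_{n,m}\cong\mathbb{R}^{nm}$ be the space of real $n\times m$ matrices, with transpose denoted by $x'$. Let $\tilde{\mathfrak{M}}_{n,m}\subset \mathfrak{M}_{n,m}$ be the open set of matrices of rank $m$, and let $V_{n,m}=\{v\in\mathfrak{M}_{n,m} : v'v=I_m\}$ be the Stiefel manifold, with the differentiable structure, of dimension $nm-m(m+1)/2$, that it inherits as an embedded submanifold of $\mathfrak{M}_{n,m}$. For a function $f:V_{n,m}\to\mathbb{C}$ let $$\tilde f(x)=f\big(x\,(x'x)^{-1/2}\big),\qquad x\in\tilde{\mathfrak{M}}_{n,m},$$ be its homogeneous extension, where $(x'x)^{-1/2}$ is the inverse of the positive definite square root of $x'x$. Then $f\in C^\infty(V_{n,m})$ if and only if $\tilde f\in C^\infty(\tilde{\mathfrak{M}}_{n,m})$. -/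

import Mathlib

open scoped Matrix Matrix.Norms.L2Operator MatrixOrder Manifold ContDiff

noncomputable section

/-! ### Slice charts of a subset of a normed space and the induced charts of the subset -/

section Slice

variable {E G K : Type*} [NormedAddCommGroup E] [NormedSpace ℝ E]
  [NormedAddCommGroup G] [NormedSpace ℝ G] [NormedAddCommGroup K] [NormedSpace ℝ K]

/-- `Φ` is a slice chart for `S ⊆ E`: a smooth diffeomorphism from an open subset `U` of `E` onto
an open subset of `G × K` with `S ∩ U = {x ∈ U | the first component of Φ x is zero}`. -/
structure IsSliceChart (S : Set E) (Φ : OpenPartialHomeomorph E (G × K)) : Prop where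
  contDiffOn : ContDiffOn ℝ ∞ Φ Φ.source
  contDiffOn_symm : ContDiffOn ℝ ∞ Φ.symm Φ.target
  mem_iff : ∀ x ∈ Φ.source, x ∈ S ↔ (Φ x).1 = 0

theorem IsSliceChart.symm_mem {S : Set E} {Φ : OpenPartialHomeomorph E (G × K)}
    (h : IsSliceChart S Φ) {y : K} (hy : ((0 : G), y) ∈ Φ.target) : Φ.symm (0, y) ∈ S := by
  rw [h.mem_iff _ (Φ.map_target hy), Φ.right_inv hy]

open Classical in
/-- The chart `x ↦ (second component of Φ x)` of the subset `S` (with its subspace topology) that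
is induced by a slice chart `Φ`. Its inverse is `y ↦ Φ⁻¹ (0, y)`; the point `p` only serves as the
irrelevant value of the inverse outside the target. -/
def IsSliceChart.restrict {S : Set E} {Φ : OpenPartialHomeomorph E (G × K)}
    (h : IsSliceChart S Φ) (p : S) : OpenPartialHomeomorph S K where
  toFun x := (Φ x).2
  invFun y := if hy : ((0 : G), y) ∈ Φ.target then ⟨Φ.symm (0, y), h.symm_mem hy⟩ else p
  source := {x | (x : E) ∈ Φ.source}
  target := {y | ((0 : G), y) ∈ Φ.target}
  map_source' x hx := by
    have h0 : ((0 : G), (Φ x).2) = Φ x := Prod.ext ((h.mem_iff _ hx).1 x.2).symm rfl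
    simp [h0, Φ.map_source hx]
  map_target' y hy := by
    have hy' : ((0 : G), y) ∈ Φ.target := hy
    simp [hy', Φ.map_target hy']
  left_inv' x hx := by
    have h0 : ((0 : G), (Φ x).2) = Φ x := Prod.ext ((h.mem_iff _ hx).1 x.2).symm rfl
    have ht : ((0 : G), (Φ x).2) ∈ Φ.target := h0 ▸ Φ.map_source hx
    rw [dif_pos ht]
    apply Subtype.ext
    change Φ.symm (0, (Φ x).2) = x
    rw [h0, Φ.left_inv hx]
  right_inv' y hy := by
    have hy' : ((0 : G), y) ∈ Φ.target := hy
    rw [dif_pos hy']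
    simp [Φ.right_inv hy']
  open_source := Φ.open_source.preimage continuous_subtype_val
  open_target := Φ.open_target.preimage (by fun_prop)
  continuousOn_toFun :=
    continuous_snd.comp_continuousOn
      (Φ.continuousOn.comp continuous_subtype_val.continuousOn fun _ hx => hx)
  continuousOn_invFun := by
    rw [Topology.IsInducing.subtypeVal.continuousOn_iff]
    refine (Φ.symm.continuousOn.comp (f := fun y : K => ((0 : G), y))
      (by fun_prop) fun _ hy => hy).congr fun y hy => ?_
    have hy' : ((0 : G), y) ∈ Φ.target := hy
    simp [hy']

theorem IsSliceChart.coe_restrict_symm {S : Set E} {Φ : OpenPartialHomeomorph E (G × K)}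
    (h : IsSliceChart S Φ) (p : S) {y : K} (hy : ((0 : G), y) ∈ Φ.target) :
    (((h.restrict p).symm y : S) : E) = Φ.symm (0, y) := by
  simp [IsSliceChart.restrict, hy]

theorem IsSliceChart.contDiffOn_transition {S : Set E} {Φ Ψ : OpenPartialHomeomorph E (G × K)}
    (h : IsSliceChart S Φ) (h' : IsSliceChart S Ψ) (p q : S) :
    ContDiffOn ℝ ∞ ((h.restrict p).symm.trans (h'.restrict q))
      ((h.restrict p).symm.trans (h'.restrict q)).source := by
  have hsrc : ∀ y ∈ ((h.restrict p).symm.trans (h'.restrict q)).source,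
      ((0 : G), y) ∈ Φ.target ∧ Φ.symm (0, y) ∈ Ψ.source := by
    intro y hy
    rw [OpenPartialHomeomorph.trans_source] at hy
    have h1 : ((0 : G), y) ∈ Φ.target := hy.1
    have h2 : (((h.restrict p).symm y : S) : E) ∈ Ψ.source := hy.2
    rw [h.coe_restrict_symm p h1] at h2
    exact ⟨h1, h2⟩
  have key : ContDiffOn ℝ ∞ (fun y : K => (Ψ (Φ.symm ((0 : G), y))).2)
      ((h.restrict p).symm.trans (h'.restrict q)).source := by
    refine contDiff_snd.comp_contDiffOn (h'.contDiffOn.comp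
      (h.contDiffOn_symm.comp (f := fun y : K => ((0 : G), y)) (by fun_prop) ?_) ?_)
    · exact fun y hy => (hsrc y hy).1
    · exact fun y hy => (hsrc y hy).2
  refine key.congr fun y hy => ?_
  change (Ψ ((h.restrict p).symm y : S)).2 = _
  rw [h.coe_restrict_symm p (hsrc y hy).1]

end Slice

/-! ### The Stiefel manifold -/

/-- The set of real `n × m` matrices with orthonormal columns. -/
def stiefel (n m : ℕ) : Set (Matrix (Fin n) (Fin m) ℝ) := {v | vᵀ * v = 1}

/-- The dimension of the Stiefel manifold. -/
def stiefelDim (n m : ℕ) : ℕ := n * m - m * (m + 1) / 2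

/-- The upper triangle of the symmetric matrix `xᵀ x - 1`, indexed by unordered pairs. -/
def gramDefect (n m : ℕ) (x : Matrix (Fin n) (Fin m) ℝ) : Sym2 (Fin m) → ℝ :=
  Sym2.lift ⟨fun i j => (xᵀ * x - 1 : Matrix (Fin m) (Fin m) ℝ) i j, fun i j => by
    have : (xᵀ * x - 1)ᵀ = xᵀ * x - 1 := by simp
    exact congrFun (congrFun this j) i⟩

theorem gramDefect_mk (n m : ℕ) (x : Matrix (Fin n) (Fin m) ℝ) (i j : Fin m) :
    gramDefect n m x s(i, j) = (xᵀ * x - 1 : Matrix (Fin m) (Fin m) ℝ) i j := rfl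

theorem mem_stiefel_iff_gramDefect {n m : ℕ} (x : Matrix (Fin n) (Fin m) ℝ) :
    x ∈ stiefel n m ↔ gramDefect n m x = 0 := by
  change xᵀ * x = 1 ↔ _
  rw [← sub_eq_zero]
  constructor
  · intro h
    funext s
    induction s with
    | h i j => rw [gramDefect_mk, h]; rfl
  · intro h
    ext i j
    rw [← gramDefect_mk, h]; rfl

theorem contDiff_gramDefect (n m : ℕ) : ContDiff ℝ ω (gramDefect n m) := by
  rw [contDiff_pi]
  intro s
  induction s with
  | h i j =>
    have he : ∀ (k : Fin n) (l : Fin m),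
        ContDiff ℝ ω fun x : Matrix (Fin n) (Fin m) ℝ => x k l := fun k l =>
      (LinearMap.toContinuousLinearMap (Matrix.entryLinearMap ℝ ℝ k l)).contDiff
    have : (fun x : Matrix (Fin n) (Fin m) ℝ => gramDefect n m x s(i, j)) =
        fun x => (∑ k, x k i * x k j) - (1 : Matrix (Fin m) (Fin m) ℝ) i j := by
      funext x
      simp [gramDefect_mk, Matrix.mul_apply]
    rw [this]
    exact (ContDiff.sum fun k _ => (he k i).mul (he k j)).sub contDiff_const

theorem fderiv_gramDefect {n m : ℕ} (x y : Matrix (Fin n) (Fin m) ℝ) (i j : Fin m) :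
    fderiv ℝ (gramDefect n m) x y s(i, j) = (xᵀ * y + yᵀ * x) i j := by
  have hd : DifferentiableAt ℝ (gramDefect n m) x :=
    (contDiff_gramDefect n m).differentiable (by simp) x
  have h1 : HasDerivAt (fun t : ℝ => x + t • y) y 0 := by
    have := ((hasDerivAt_id (0 : ℝ)).smul_const y).const_add x
    rwa [one_smul] at this
  have h2 : HasDerivAt (fun t : ℝ => gramDefect n m (x + t • y))
      (fderiv ℝ (gramDefect n m) x y) 0 := by
    have h0 : x + (0 : ℝ) • y = x := by rw [zero_smul, add_zero]
    have := hd.hasFDerivAt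
    exact HasFDerivAt.comp_hasDerivAt (0 : ℝ) (by rwa [h0]) h1
  have h3 := (hasDerivAt_pi.1 h2) s(i, j)
  have h4 : (fun t : ℝ => gramDefect n m (x + t • y) s(i, j)) = fun t =>
      (xᵀ * x - 1 : Matrix (Fin m) (Fin m) ℝ) i j + t * (xᵀ * y + yᵀ * x) i j + t * t * (yᵀ * y) i j := by
    funext t
    rw [gramDefect_mk]
    simp [Matrix.add_mul, Matrix.mul_add]
    ring
  rw [h4] at h3
  have h5 : HasDerivAt (fun t : ℝ =>
      (xᵀ * x - 1 : Matrix (Fin m) (Fin m) ℝ) i j + t * (xᵀ * y + yᵀ * x) i j + t * t * (yᵀ * y) i j)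
      ((xᵀ * y + yᵀ * x) i j) 0 := by
    have := (((hasDerivAt_id (0 : ℝ)).mul_const ((xᵀ * y + yᵀ * x) i j)).const_add
      ((xᵀ * x - 1 : Matrix (Fin m) (Fin m) ℝ) i j)).add (((hasDerivAt_id (0 : ℝ)).mul (hasDerivAt_id (0 : ℝ))).mul_const
        ((yᵀ * y) i j))
    refine (this.congr_deriv ?_).congr_of_eventuallyEq (Filter.EventuallyEq.of_eq ?_)
    · simp
    · rfl
  exact h3.unique h5

theorem range_fderiv_gramDefect {n m : ℕ} {p : Matrix (Fin n) (Fin m) ℝ} (hp : p ∈ stiefel n m) :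
    (fderiv ℝ (gramDefect n m) p).range = ⊤ := by
  rw [LinearMap.range_eq_top]
  intro g
  have hp' : pᵀ * p = 1 := hp
  set A : Matrix (Fin m) (Fin m) ℝ := Matrix.of fun i j => g s(i, j) with hA
  have hAt : Aᵀ = A := by
    ext i j
    simp [hA, Sym2.eq_swap]
  refine ⟨p * ((1 / 2 : ℝ) • A), ?_⟩
  funext s
  induction s with
  | h i j =>
    refine (fderiv_gramDefect p _ i j).trans ?_
    have h1 : pᵀ * (p * ((1 / 2 : ℝ) • A)) = (1 / 2 : ℝ) • A := by
      rw [← Matrix.mul_assoc, hp', Matrix.one_mul]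
    have h2 : (p * ((1 / 2 : ℝ) • A))ᵀ * p = (1 / 2 : ℝ) • A := by
      rw [Matrix.transpose_mul, Matrix.mul_assoc, hp', Matrix.mul_one, Matrix.transpose_smul, hAt]
    rw [h1, h2, ← add_smul]
    norm_num [hA]

theorem finrank_ker_fderiv_gramDefect {n m : ℕ} {p : Matrix (Fin n) (Fin m) ℝ}
    (hp : p ∈ stiefel n m) :
    Module.finrank ℝ (fderiv ℝ (gramDefect n m) p).ker = stiefelDim n m := by
  have h := (fderiv ℝ (gramDefect n m) p).toLinearMap.finrank_range_add_finrank_ker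
  have hr := range_fderiv_gramDefect hp
  have hr' : Module.finrank ℝ (fderiv ℝ (gramDefect n m) p).range = m * (m + 1) / 2 := by
    rw [hr, finrank_top, Module.finrank_pi, Sym2.card, Fintype.card_fin, Nat.choose_two_right,
      Nat.add_sub_cancel, mul_comm]
  rw [hr', Module.finrank_matrix] at h
  simp at h
  unfold stiefelDim
  omega

/-- Around each of its points the Stiefel manifold has a slice chart. -/
theorem exists_isSliceChart_stiefel {n m : ℕ} (p : stiefel n m) :
    ∃ Φ : OpenPartialHomeomorph (Matrix (Fin n) (Fin m) ℝ)
        ((Sym2 (Fin m) → ℝ) × EuclideanSpace ℝ (Fin (stiefelDim n m))),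
      IsSliceChart (stiefel n m) Φ ∧ (p : Matrix (Fin n) (Fin m) ℝ) ∈ Φ.source := by
  have hp := p.2
  set f' := fderiv ℝ (gramDefect n m) p with hf'
  have hc : ContDiff ℝ ω (gramDefect n m) := contDiff_gramDefect n m
  have hs : HasStrictFDerivAt (gramDefect n m) f' p :=
    hc.contDiffAt.hasStrictFDerivAt (by simp)
  have hr : f'.range = ⊤ := range_fderiv_gramDefect hp
  let e : f'.ker ≃L[ℝ] EuclideanSpace ℝ (Fin (stiefelDim n m)) :=
    ContinuousLinearEquiv.ofFinrankEq (by
      rw [finrank_euclideanSpace_fin]; exact finrank_ker_fderiv_gramDefect hp)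
  let D := HasStrictFDerivAt.implicitFunctionDataOfComplemented (gramDefect n m) f' hs hr
    f'.ker_closedComplemented_of_finiteDimensional_range
  let Φ₀ := D.toOpenPartialHomeomorph
  have hΦ₀c : ContDiff ℝ ω Φ₀ := by
    refine hc.prodMk ?_
    exact ContDiff.comp (g := D.rightDeriv) (f := fun x => x - (p : Matrix (Fin n) (Fin m) ℝ))
      (ContinuousLinearMap.contDiff _) (contDiff_id.sub contDiff_const)
  have hp0 : (p : Matrix (Fin n) (Fin m) ℝ) ∈ Φ₀.source :=
    D.pt_mem_toOpenPartialHomeomorph_source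
  have hsymm : ContDiffAt ℝ ω Φ₀.symm (Φ₀ p) := by
    have hd := D.hasStrictFDerivAt.hasFDerivAt
    refine Φ₀.contDiffAt_symm (Φ₀.map_source hp0) (f₀' := D.leftDeriv.equivProdOfSurjectiveOfIsCompl
      D.rightDeriv D.range_leftDeriv D.range_rightDeriv D.isCompl_ker) ?_ hΦ₀c.contDiffAt
    rw [Φ₀.left_inv hp0]
    exact hd
  have hω : (ω : ℕ∞ω) ≠ ∞ := by simp
  let Φ₁ := Φ₀.restrContDiff ℝ ω hω
  let L := (ContinuousLinearEquiv.refl ℝ (Sym2 (Fin m) → ℝ)).prodCongr e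
  refine ⟨Φ₁.trans L.toHomeomorph.toOpenPartialHomeomorph, ⟨?_, ?_, ?_⟩, ?_⟩
  · exact ((L.contDiff.comp hΦ₀c).of_le le_top).contDiffOn
  · intro y hy
    have hy1 : L.symm y ∈ Φ₁.target := by
      rw [OpenPartialHomeomorph.trans_target] at hy
      exact hy.2
    have h1 : ContDiffAt ℝ ∞ Φ₀.symm (L.symm y) := hy1.2.1.of_le le_top
    exact (h1.comp y (L.symm.contDiff.contDiffAt)).contDiffWithinAt
  · intro x _
    exact mem_stiefel_iff_gramDefect x
  · rw [OpenPartialHomeomorph.trans_source]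
    refine ⟨⟨hp0, hΦ₀c.contDiffAt, hsymm⟩, Set.mem_univ _⟩

/-- The manifold structure of the Stiefel manifold, inherited from the space of all matrices: its
charts are those induced by the slice charts. -/
instance stiefelChartedSpace (n m : ℕ) :
    ChartedSpace (EuclideanSpace ℝ (Fin (stiefelDim n m))) (stiefel n m) where
  atlas := {e | ∃ (Φ : OpenPartialHomeomorph (Matrix (Fin n) (Fin m) ℝ)
      ((Sym2 (Fin m) → ℝ) × EuclideanSpace ℝ (Fin (stiefelDim n m))))
      (h : IsSliceChart (stiefel n m) Φ) (p : stiefel n m), e = h.restrict p}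
  chartAt p := (exists_isSliceChart_stiefel p).choose_spec.1.restrict p
  mem_chart_source p := (exists_isSliceChart_stiefel p).choose_spec.2
  chart_mem_atlas p := ⟨_, (exists_isSliceChart_stiefel p).choose_spec.1, p, rfl⟩

instance stiefel_isManifold (n m : ℕ) :
    IsManifold 𝓘(ℝ, EuclideanSpace ℝ (Fin (stiefelDim n m))) ∞ (stiefel n m) := by
  apply isManifold_of_contDiffOn
  rintro e e' ⟨Φ, h, p, rfl⟩ ⟨Ψ, h', q, rfl⟩
  simpa only [modelWithCornersSelf_coe, modelWithCornersSelf_coe_symm, Function.comp_id,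
    Function.id_comp, Set.preimage_id, Set.range_id, Set.inter_univ] using
    h.contDiffOn_transition h' p q

/-- The Stiefel manifold is an embedded submanifold of the space of matrices. -/
theorem stiefel_isSmoothEmbedding (n m : ℕ) :
    Manifold.IsSmoothEmbedding 𝓘(ℝ, EuclideanSpace ℝ (Fin (stiefelDim n m)))
      𝓘(ℝ, Matrix (Fin n) (Fin m) ℝ) ∞
      (Subtype.val : stiefel n m → Matrix (Fin n) (Fin m) ℝ) := by
  refine ⟨?_, Topology.IsEmbedding.subtypeVal⟩
  have hdim : ∀ p : stiefel n m, Module.finrank ℝ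
      (EuclideanSpace ℝ (Fin (stiefelDim n m)) × (Sym2 (Fin m) → ℝ)) =
      Module.finrank ℝ (Matrix (Fin n) (Fin m) ℝ) := by
    intro p
    have h := (fderiv ℝ (gramDefect n m) p).toLinearMap.finrank_range_add_finrank_ker
    have hr := range_fderiv_gramDefect p.2
    have hk := finrank_ker_fderiv_gramDefect p.2
    rw [← h, Module.finrank_prod, finrank_euclideanSpace_fin]
    erw [hr, hk, finrank_top]
    omega
  refine ⟨Sym2 (Fin m) → ℝ, inferInstance, inferInstance, fun p => ?_⟩
  obtain ⟨Φ, h, hp⟩ := exists_isSliceChart_stiefel p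
  let L := ContinuousLinearEquiv.ofFinrankEq (𝕜 := ℝ) (hdim p)
  let L' := (ContinuousLinearEquiv.prodComm ℝ (Sym2 (Fin m) → ℝ)
    (EuclideanSpace ℝ (Fin (stiefelDim n m)))).trans L
  let Ψ := Φ.trans L'.toHomeomorph.toOpenPartialHomeomorph
  refine .mk_of_charts L (h.restrict p) Ψ hp ?_ ?_ ?_ ?_ ?_
  · exact ⟨hp, Set.mem_univ _⟩
  · exact IsManifold.subset_maximalAtlas ⟨Φ, h, p, rfl⟩
  · apply StructureGroupoid.mem_maximalAtlas_of_mem_groupoid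
    rw [contDiffGroupoid, mem_groupoid_of_pregroupoid]
    simp only [contDiffPregroupoid, modelWithCornersSelf_coe, modelWithCornersSelf_coe_symm,
      Function.comp_id, Function.id_comp, Set.preimage_id, Set.range_id, Set.inter_univ]
    refine ⟨?_, ?_⟩
    · exact L'.contDiff.comp_contDiffOn (h.contDiffOn.mono fun x hx => hx.1)
    · exact h.contDiffOn_symm.comp L'.symm.contDiff.contDiffOn fun x hx => hx.2
  · intro x hx
    exact ⟨hx, Set.mem_univ _⟩
  · intro y hy
    have hy' : ((0 : Sym2 (Fin m) → ℝ), y) ∈ Φ.target := by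
      rw [OpenPartialHomeomorph.extend_target] at hy
      exact hy.1
    change L' (Φ ((h.restrict p).symm y : stiefel n m)) = L (y, 0)
    rw [h.coe_restrict_symm p hy', Φ.right_inv hy']
    rfl

/-! ### Matrices of full rank and the homogeneous extension -/

theorem rank_eq_iff_det_gram_ne_zero {n m : ℕ} (x : Matrix (Fin n) (Fin m) ℝ) :
    x.rank = m ↔ (xᵀ * x).det ≠ 0 := by
  rw [← Matrix.rank_transpose_mul_self, ← isUnit_iff_ne_zero, ← Matrix.isUnit_iff_isUnit_det]
  constructor
  · intro h
    rw [← Matrix.mulVec_surjective_iff_isUnit]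
    have hr : (xᵀ * x).mulVecLin.range = ⊤ := by
      apply Submodule.eq_top_of_finrank_eq
      rw [Module.finrank_fin_fun]
      exact h
    exact LinearMap.range_eq_top.1 hr
  · intro h
    simpa using Matrix.rank_of_isUnit _ h

/-- The open set of real `n × m` matrices of rank `m`. -/
def fullRank (n m : ℕ) : TopologicalSpace.Opens (Matrix (Fin n) (Fin m) ℝ) where
  carrier := {x | x.rank = m}
  is_open' := by
    have : {x : Matrix (Fin n) (Fin m) ℝ | x.rank = m} = {x | (xᵀ * x).det ≠ 0} := by
      ext x
      exact rank_eq_iff_det_gram_ne_zero x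
    rw [this]
    exact isOpen_ne_fun (by fun_prop) continuous_const

/-- The polar projection `x ↦ x (xᵀ x)^(-1/2)`. -/
def polarProj {n m : ℕ} (x : fullRank n m) : stiefel n m :=
  ⟨(x : Matrix (Fin n) (Fin m) ℝ) *
      ((x : Matrix (Fin n) (Fin m) ℝ)ᵀ * (x : Matrix (Fin n) (Fin m) ℝ)) ^ (-(1 / 2) : ℝ), by
    have hdet := (rank_eq_iff_det_gram_ne_zero (x : Matrix (Fin n) (Fin m) ℝ)).1 x.2
    set r := (x : Matrix (Fin n) (Fin m) ℝ)ᵀ * (x : Matrix (Fin n) (Fin m) ℝ) with hr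
    have hu : IsUnit r := (Matrix.isUnit_iff_isUnit_det r).2 (isUnit_iff_ne_zero.2 hdet)
    have h0 : 0 ≤ r := (Matrix.posSemidef_conjTranspose_mul_self
      (x : Matrix (Fin n) (Fin m) ℝ)).nonneg
    have hs : (r ^ (-(1 / 2) : ℝ))ᵀ = r ^ (-(1 / 2) : ℝ) :=
      (Matrix.nonneg_iff_posSemidef.1 (CFC.rpow_nonneg (a := r) (y := -(1 / 2)))).isHermitian
    have h1 : r * r ^ (-(1 / 2) : ℝ) = r ^ (1 / 2 : ℝ) := by
      nth_rewrite 1 [← CFC.rpow_one r]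
      rw [← CFC.rpow_add hu]
      norm_num
    change ((x : Matrix (Fin n) (Fin m) ℝ) * r ^ (-(1 / 2) : ℝ))ᵀ *
      ((x : Matrix (Fin n) (Fin m) ℝ) * r ^ (-(1 / 2) : ℝ)) = 1
    rw [Matrix.transpose_mul, hs, Matrix.mul_assoc, ← Matrix.mul_assoc _ _ (r ^ _), ← hr, h1,
      ← CFC.rpow_add hu]
    norm_num
    exact CFC.rpow_zero r⟩

/-- The homogeneous extension `x ↦ f (x (xᵀ x)^(-1/2))` of a function on the Stiefel manifold. -/
def homogeneousExtension {n m : ℕ} (f : stiefel n m → ℂ) (x : fullRank n m) : ℂ :=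
  f (polarProj x)

end

/-! The polar projection `π x = x (xᵀ x)^(-1/2)` is a smooth retraction of the full-rank matrices
onto the Stiefel manifold. The homogeneous extension of `f` is `f ∘ π`, so it is smooth when `f` is;
conversely `f` is its composition with the smooth inclusion `ι`, since `π ∘ ι = id`.

The substance is the smoothness of `π`. The map `y ↦ (yᵀ y)^(-1/2)` is continuous by the functional
calculus, and its square `(yᵀ y)⁻¹` is smooth. Squaring has derivative `H ↦ A H + H A`, which is
invertible at positive definite `A`, so the inverse function theorem makes the root itself smooth
(`contDiffAt_gram_rpow`). Values in the Stiefel manifold are handled by its being embedded. -/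

/-- A map that is continuous at `b` is as smooth there as its composition with a smooth map whose
derivative at the image point is invertible. -/
theorem ContinuousAt.contDiffAt_of_comp {E F G : Type*} [NormedAddCommGroup E] [NormedSpace ℝ E]
    [NormedAddCommGroup F] [NormedSpace ℝ F] [CompleteSpace F]
    [NormedAddCommGroup G] [NormedSpace ℝ G]
    {k : ℕ∞ω} (hk : k ≠ 0) {p : E → F} {φ : F → G} {b : E} (hp : ContinuousAt p b)
    (hφ : ContDiffAt ℝ k φ (p b)) {φ' : F ≃L[ℝ] G}
    (hφ' : HasFDerivAt φ (φ' : F →L[ℝ] G) (p b)) (h : ContDiffAt ℝ k (φ ∘ p) b) :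
    ContDiffAt ℝ k p b := by
  -- Continuity keeps `p x` near `p b`, where the local inverse of `φ` undoes `φ`; hence `p` is
  -- locally that inverse after `φ ∘ p`.
  have hinv := (hφ.hasStrictFDerivAt' hφ' hk).eventually_left_inverse
  exact (ContDiffAt.comp b (hφ.to_localInverse hφ' hk) h).congr_of_eventuallyEq
    ((hp.eventually hinv).mono fun _ hx => hx.symm)

/-- Uniqueness for the Lyapunov equation with a positive definite coefficient. -/
theorem Matrix.PosDef.eq_zero_of_mul_add_mul_eq_zero {m : Type*} [Fintype m] [DecidableEq m]
    {A H : Matrix m m ℝ} (hA : A.PosDef) (h : A * H + H * A = 0) : H = 0 := by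
  -- The two traces are nonnegative and sum to the trace of `Hᴴ (A H + H A) = 0`, so both vanish.
  have h1 := (hA.posSemidef.conjTranspose_mul_mul_same H).trace_nonneg
  have h2 := (hA.posSemidef.mul_mul_conjTranspose_same H).trace_nonneg
  have h3 : (Hᴴ * A * H).trace + (H * A * Hᴴ).trace = 0 := by
    rw [Matrix.trace_mul_comm (H * A), Matrix.mul_assoc, ← Matrix.trace_add, ← Matrix.mul_add, h,
      Matrix.mul_zero, Matrix.trace_zero]
  have h4 : (Hᴴ * A * H).trace = 0 := by linarith
  -- With `A = Bᴴ B`, the vanishing trace is that of `(B H)ᴴ (B H)`, which forces `B H = 0`.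
  obtain ⟨B, hB⟩ := CStarAlgebra.nonneg_iff_eq_star_mul_self.1 hA.posSemidef.nonneg
  have hBu : IsUnit B := by
    have := hA.isUnit
    rw [hB] at this
    rw [Matrix.isUnit_iff_isUnit_det] at this ⊢
    rw [Matrix.det_mul] at this
    exact isUnit_of_mul_isUnit_right this
  have h5 : B * H = 0 := by
    rw [← Matrix.trace_conjTranspose_mul_self_eq_zero_iff, ← h4, hB]
    simp [Matrix.mul_assoc, Matrix.star_eq_conjTranspose]
  exact (hBu.mul_right_eq_zero).1 h5

/-- The derivative of the squaring map at a positive definite matrix, as an isomorphism. -/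
theorem Matrix.PosDef.exists_hasFDerivAt_mul_self {m : Type*} [Fintype m] [DecidableEq m]
    {A : Matrix m m ℝ} (hA : A.PosDef) :
    ∃ φ' : Matrix m m ℝ ≃L[ℝ] Matrix m m ℝ,
      HasFDerivAt (fun X : Matrix m m ℝ => X * X) (φ' : Matrix m m ℝ →L[ℝ] Matrix m m ℝ) A := by
  let L : Matrix m m ℝ →ₗ[ℝ] Matrix m m ℝ := LinearMap.mulLeft ℝ A + LinearMap.mulRight ℝ A
  have hL : Function.Injective L :=
    (injective_iff_map_eq_zero L).2 fun H hH => hA.eq_zero_of_mul_add_mul_eq_zero hH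
  refine ⟨(LinearEquiv.ofInjectiveEndo L hL).toContinuousLinearEquiv, ?_⟩
  refine ((hasFDerivAt_id A).mul' (hasFDerivAt_id A)).congr_fderiv ?_
  ext1 H
  rfl

/-! ### Smoothness of the inverse square root of the Gram matrix -/

theorem gram_isStrictlyPositive {n m : ℕ} (x : fullRank n m) :
    IsStrictlyPositive ((x : Matrix (Fin n) (Fin m) ℝ)ᵀ * (x : Matrix (Fin n) (Fin m) ℝ)) := by
  have hdet := (rank_eq_iff_det_gram_ne_zero (x : Matrix (Fin n) (Fin m) ℝ)).1 x.2
  exact ((Matrix.isUnit_iff_isUnit_det _).2 (isUnit_iff_ne_zero.2 hdet)).isStrictlyPositive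
    (Matrix.posSemidef_conjTranspose_mul_self (x : Matrix (Fin n) (Fin m) ℝ)).nonneg

/-- The product of smooth families of rectangular matrices is smooth. -/
theorem ContDiffAt.matrix_mul {E : Type*} [NormedAddCommGroup E] [NormedSpace ℝ E]
    {l m n : Type*} [Fintype l] [Fintype m] [Fintype n] [DecidableEq m] [DecidableEq n]
    {k : ℕ∞ω} {f : E → Matrix l m ℝ} {g : E → Matrix m n ℝ} {x : E}
    (hf : ContDiffAt ℝ k f x) (hg : ContDiffAt ℝ k g x) :
    ContDiffAt ℝ k (fun y => f y * g y) x := by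
  let B : Matrix l m ℝ →ₗ[ℝ] Matrix m n ℝ →ₗ[ℝ] Matrix l n ℝ :=
    LinearMap.mk₂ ℝ (fun X Y => X * Y) (fun _ _ _ => Matrix.add_mul _ _ _)
      (fun _ _ _ => Matrix.smul_mul _ _ _) (fun _ _ _ => Matrix.mul_add _ _ _)
      (fun _ _ _ => Matrix.mul_smul _ _ _)
  exact B.toContinuousBilinearMap.isBoundedBilinearMap.contDiff.contDiffAt.comp x (hf.prodMk hg)

theorem contDiff_gram (n m : ℕ) :
    ContDiff ℝ ∞ fun x : Matrix (Fin n) (Fin m) ℝ => xᵀ * x :=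
  contDiff_iff_contDiffAt.2 fun _ => ContDiffAt.matrix_mul
    (LinearMap.toContinuousLinearMap
      (Matrix.transposeLinearEquiv (Fin n) (Fin m) ℝ ℝ).toLinearMap).contDiff.contDiffAt
    contDiffAt_id

/-- Only continuity of the real power is taken from the functional calculus; smoothness is recovered
through `ContinuousAt.contDiffAt_of_comp`, with squaring as the outer map. -/
theorem contDiffAt_gram_rpow {n m : ℕ} (x : fullRank n m) :
    ContDiffAt ℝ ∞ (fun y : Matrix (Fin n) (Fin m) ℝ => (yᵀ * y) ^ (-(1 / 2) : ℝ)) x := by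
  have hgram := contDiff_gram n m
  have hev : ∀ᶠ y in nhds (x : Matrix (Fin n) (Fin m) ℝ), IsStrictlyPositive (yᵀ * y) :=
    Filter.mem_of_superset ((fullRank n m).isOpen.mem_nhds x.2)
      fun y hy => gram_isStrictlyPositive ⟨y, hy⟩
  have hx := gram_isStrictlyPositive x
  have hcont : ContinuousAt
      (fun y : Matrix (Fin n) (Fin m) ℝ => (yᵀ * y) ^ (-(1 / 2) : ℝ)) x := by
    have h1 := (CFC.continuousOn_rpow (A := Matrix (Fin m) (Fin m) ℝ) (-(1 / 2))) _ hx
    exact h1.tendsto.comp (tendsto_nhdsWithin_iff.2 ⟨hgram.continuous.continuousAt, hev⟩)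
  obtain ⟨φ', hφ'⟩ :=
    (Matrix.isStrictlyPositive_iff_posDef.1 (hx.rpow (y := -(1 / 2)))).exists_hasFDerivAt_mul_self
  refine hcont.contDiffAt_of_comp (by simp) (φ := fun X => X * X)
    (contDiff_id.mul contDiff_id).contDiffAt hφ' ?_
  obtain ⟨u, hu⟩ := hx.isUnit
  have hinv : ContDiffAt ℝ ∞ (Ring.inverse : Matrix (Fin m) (Fin m) ℝ → _)
      ((x : Matrix (Fin n) (Fin m) ℝ)ᵀ * (x : Matrix (Fin n) (Fin m) ℝ)) :=
    hu ▸ contDiffAt_ringInverse ℝ u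
  -- The square equals the inverse Gram matrix at full-rank `y`, an open condition, so the two agree
  -- near `x`.
  refine (ContDiffAt.comp (x : Matrix (Fin n) (Fin m) ℝ)
    (f := fun y : Matrix (Fin n) (Fin m) ℝ => yᵀ * y) hinv hgram.contDiffAt).congr_of_eventuallyEq
    (hev.mono fun y hy => ?_)
  change (yᵀ * y) ^ (-(1 / 2) : ℝ) * (yᵀ * y) ^ (-(1 / 2) : ℝ) = Ring.inverse (yᵀ * y)
  rw [CFC.inverse_eq_rpow_neg_one hy, ← CFC.rpow_add hy.isUnit]
  norm_num

/-! ### The polar projection as a smooth retraction -/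

/-- The polar projection is smooth. -/
theorem contMDiff_polarProj (n m : ℕ) :
    ContMDiff 𝓘(ℝ, Matrix (Fin n) (Fin m) ℝ) 𝓘(ℝ, EuclideanSpace ℝ (Fin (stiefelDim n m))) ∞
      (polarProj : fullRank n m → stiefel n m) := by
  have hval : ContMDiff 𝓘(ℝ, Matrix (Fin n) (Fin m) ℝ) 𝓘(ℝ, Matrix (Fin n) (Fin m) ℝ) ∞
      (Subtype.val ∘ (polarProj : fullRank n m → stiefel n m)) := by
    intro x
    refine (contMDiffAt_subtype_iff
      (f := fun y : Matrix (Fin n) (Fin m) ℝ => y * (yᵀ * y) ^ (-(1 / 2) : ℝ))).2 ?_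
    exact (contDiffAt_id.matrix_mul (contDiffAt_gram_rpow x)).contMDiffAt
  -- A map into an immersed manifold is smooth once it is continuous and smooth into the ambient
  -- space; continuity follows because the topology is the subspace one.
  exact (ContMDiff.iff_comp_isImmersion (stiefel_isSmoothEmbedding n m).isImmersion).2
    ⟨Topology.IsInducing.subtypeVal.continuous_iff.2 hval.continuous, hval⟩

theorem stiefel_subset_fullRank (n m : ℕ) : stiefel n m ⊆ fullRank n m := by
  intro v hv
  refine (rank_eq_iff_det_gram_ne_zero v).2 ?_
  rw [show vᵀ * v = 1 from hv]
  simp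

theorem contMDiff_stiefel_inclusion (n m : ℕ) :
    ContMDiff 𝓘(ℝ, EuclideanSpace ℝ (Fin (stiefelDim n m))) 𝓘(ℝ, Matrix (Fin n) (Fin m) ℝ) ∞
      (fun v : stiefel n m => (⟨v, stiefel_subset_fullRank n m v.2⟩ : fullRank n m)) :=
  (ContMDiff.subtypeVal_comp_iff _ _).1 (stiefel_isSmoothEmbedding n m).isImmersion.contMDiff

theorem polarProj_of_mem_stiefel {n m : ℕ} (v : stiefel n m) :
    polarProj ⟨v, stiefel_subset_fullRank n m v.2⟩ = v := by
  apply Subtype.ext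
  change (v : Matrix (Fin n) (Fin m) ℝ) *
    ((v : Matrix (Fin n) (Fin m) ℝ)ᵀ * (v : Matrix (Fin n) (Fin m) ℝ)) ^ (-(1 / 2) : ℝ) = v
  rw [show (v : Matrix (Fin n) (Fin m) ℝ)ᵀ * (v : Matrix (Fin n) (Fin m) ℝ) = 1 from v.2,
    CFC.one_rpow, Matrix.mul_one]

theorem mainTheorem11 (n m : ℕ) (hmn : m ≤ n) (f : stiefel n m → ℂ) :
    ContMDiff 𝓘(ℝ, EuclideanSpace ℝ (Fin (stiefelDim n m))) 𝓘(ℝ, ℂ) ∞ f ↔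
      ContMDiff 𝓘(ℝ, Matrix (Fin n) (Fin m) ℝ) 𝓘(ℝ, ℂ) ∞ (homogeneousExtension f) := by
  refine ⟨fun hf => hf.comp (contMDiff_polarProj n m), fun hf => ?_⟩
  -- Restricting the extension along the inclusion returns `f`, as `polarProj` fixes the Stiefel
  -- manifold pointwise.
  refine (hf.comp (contMDiff_stiefel_inclusion n m)).congr fun v => ?_
  exact congrArg f (polarProj_of_mem_stiefel v).symm
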